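/- Let $V$ be a valuation domain of rank one (i.e. of Krull dimension one) that is not a discrete valuation ring, let $K$ be its quotient field, and let $v\colon K\to\mathbb{R}\cup\{\infty\}$ be its valuation. A sequence $E=\{s_n\}_{n\in\mathbb{N}}$ in $K$ is *pseudo-convergent* if $v(s_{n+1}-s_n)<v(s_{n+2}-s_{n+1})$ for all $n\in\mathbb{N}$. For such a sequence put $$V_E=\{\phi\in K(X)\mid \phi(s_n)\in V\text{ for all but finitely many }n\in\mathbb{N}\},$$ which is a valuation domain of $K(X)$ containing $V$, and, for $\phi\in K(X)$, $$w_E(\phi)=\lim_{n\to\infty}v(\phi(s_n))\in\mathbb{R}\cup\{\pm\infty\}.$$ Whenever $w_E$ is a valuation on $K(X)$, let $W_E=\{\phi\in K(X)\mid w_E(\phi)\ge 0\}$ be its valuation domain. Let $\mathrm{Zar}(K(X)|V)$ be the set of all valuation domains of $K(X)$ containing $V$, with the Zariski topology, i.e. the topology generated by the sets $B(\phi)=\{A\mid \phi\in A\}$, $\phi\in K(X)$. Endow $$\mathcal{V}=\{V_E\mid E\subset K\text{ is a pseudo-convergent sequence}\},$$ $$\mathcal{W}=\{W_E\mid E\subset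 K\text{ is a pseudo-convergent sequence and }w_E\text{ is a valuation}\}$$ with the subspace topologies inherited from $\mathrm{Zar}(K(X)|V)$. Then there is a well-defined map $\Psi\colon\mathcal{W}\to\mathcal{V}$ such that $\Psi(W_E)=V_E$ for every pseudo-convergent sequence $E\subset K$ for which $w_E$ is a valuation. The map $\Psi$ is continuous and injective, but it is not a topological embedding (a homeomorphism onto its image). -/

import Mathlib

open Filter Topology
open scoped NNReal

namespace PseudoConvergent

/-- The Zariski space `Zar(L|D)`: the valuation domains of the field `L` that contain (the image
of) `D`. -/
structure Zar (D L : Type*) [CommRing D] [Field L] [Algebra D L] where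
  /-- The valuation domain of `L`. -/
  ring : ValuationSubring L
  algebraMap_mem : ∀ d : D, algebraMap D L d ∈ ring

namespace Zar

variable {D L : Type*} [CommRing D] [Field L] [Algebra D L]

/-- The subbasic open set `B(φ)`: the members of `Zar(L|D)` that contain `φ`. -/
def basicSet (φ : L) : Set (Zar D L) := {A | φ ∈ A.ring}

/-- The Zariski topology on `Zar(L|D)`, generated by the sets `B(φ)` for `φ ∈ L`. -/
instance : TopologicalSpace (Zar D L) :=
  TopologicalSpace.generateFrom (Set.range basicSet)

end Zar

variable {K : Type*} [Field K]

/-- A sequence `s` in `K` is pseudo-convergent for `v` if the additive values of the differences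
`s (n + 1) - s n` are strictly increasing. Valuations are written multiplicatively, so the order
is reversed: `v x = exp (-(additive value of x))`. -/
def IsPseudoConvergent (v : Valuation K ℝ≥0) (s : ℕ → K) : Prop :=
  ∀ n : ℕ, v (s (n + 2) - s (n + 1)) < v (s (n + 1) - s n)

/-- The set `V_E` for `E = {s n}`: the rational functions `φ` such that `φ (s n)` is defined and
lies in the valuation domain `V` of `v` for all but finitely many `n`. -/
def VE (v : Valuation K ℝ≥0) (s : ℕ → K) : Set (RatFunc K) :=
  {φ | ∀ᶠ n in atTop,
    φ.denom.eval (s n) ≠ 0 ∧ φ.eval (RingHom.id K) (s n) ∈ v.valuationSubring}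

/-- The map `w_E : φ ↦ lim v (φ (s n))` is defined on all of `K(X)` and is the (real-valued)
valuation `w` of `K(X)`. The terms of a pseudo-convergent sequence are distinct, so `s n` is a pole
of `φ` for finitely many `n` only and the value of `RatFunc.eval` at a pole plays no role. -/
def IsOstrowskiValuation (v : Valuation K ℝ≥0) (s : ℕ → K)
    (w : Valuation (RatFunc K) ℝ≥0) : Prop :=
  ∀ φ : RatFunc K, Tendsto (fun n => v (φ.eval (RingHom.id K) (s n))) atTop (𝓝 (w φ))

/-- The space `𝒱` of all the valuation domains `V_E`, `E` a pseudo-convergent sequence in `K`,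
inside `Zar(K(X)|V)`. -/
def spaceV (v : Valuation K ℝ≥0) : Set (Zar v.valuationSubring (RatFunc K)) :=
  {A | ∃ s : ℕ → K, IsPseudoConvergent v s ∧ (A.ring : Set (RatFunc K)) = VE v s}

/-- The space `𝒲` of all the valuation domains `W_E = {φ | w_E φ ≥ 0}` (additively),
`E` a pseudo-convergent sequence in `K` such that `w_E` is a valuation, inside `Zar(K(X)|V)`. -/
def spaceW (v : Valuation K ℝ≥0) : Set (Zar v.valuationSubring (RatFunc K)) :=
  {A | ∃ (s : ℕ → K) (w : Valuation (RatFunc K) ℝ≥0),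
    IsPseudoConvergent v s ∧ IsOstrowskiValuation v s w ∧ A.ring = w.valuationSubring}

end PseudoConvergent

namespace PseudoConvergent

/-! ### Extending the valuation to the algebraic closure -/

section Extension

open UniformSpace

/-! Extend `v` to a valuation `u` of the algebraic closure and factor polynomials there. Along a
pseudo-convergent `E`, the distance to a root is eventually constant unless the root is a
pseudo-limit of `E`, in which case it is the gap itself, which decreases strictly to the breadth δ.
So `v (φ (s n))` is eventually γ · (gap)^k with k the `limitOrder` of φ, and φ lies in V_E exactly
when w_E(φ) < 1, or w_E(φ) = 1 and k ≤ 0 (multiplicative notation). As w_E determines the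
pseudo-limits of `E`, it determines V_E. The value group is dense in the reals, rank one and
non-discreteness being used here, so W_E determines w_E and Ψ is well defined; W_E is recovered from
V_E as the set of φ with cφ in V_E whenever v(c) < 1, so Ψ is injective.

Continuity (`exists_finset`) is delicate when w_E(φ) = 1. The set W_E must then have a neighbourhood
defined by finitely many inequalities w(ψ) ≤ 1 that forces φ into V_F. One inequality puts the late
terms of `F` in a ball where only the limit roots matter; a lower bound on the value of numerator
times denominator prevents those terms from coming too close to the limit roots. Outside that
excluded region the value of φ is governed by a comparison γ₁ρ^a ≤ γ₂ρ^b.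

Ψ is not an embedding: if v(s n) decreases to 1 and F_k = s k · E, then V_{F_k} tends to V_E, while
X lies in W_E and in no W_{F_k}. -/

lemma isUltrametricDist_completion (F : Type*) [NormedField F] [IsUltrametricDist F] :
    IsUltrametricDist (Completion F) := by
  refine IsUltrametricDist.isUltrametricDist_of_forall_norm_add_le_max_norm fun x y => ?_
  induction x, y using Completion.induction_on₂ with
  | hp => exact isClosed_le (by fun_prop) (by fun_prop)
  | ih a b =>
    rw [← Completion.coe_add, Completion.norm_coe, Completion.norm_coe, Completion.norm_coe]
    exact IsUltrametricDist.norm_add_le_max a b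

/-- A multiplicative algebra norm that is nonarchimedean, as a valuation. -/
noncomputable def valuationOfMulAlgebraNorm {F L : Type*} [NormedField F] [Field L] [Algebra F L]
    (f : MulAlgebraNorm F L) (hf : IsNonarchimedean f) : Valuation L ℝ≥0 where
  toFun x := NNReal.mk (f x) (apply_nonneg f x)
  map_zero' := NNReal.eq (map_zero f)
  map_one' := NNReal.eq (map_one f)
  map_mul' x y := NNReal.eq (map_mul f x y)
  map_add_le_max' x y := by
    rw [← NNReal.coe_le_coe, NNReal.coe_max]
    exact hf x y

/-- A nontrivial real valuation extends to the algebraic closure. -/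
theorem exists_extension_algebraicClosure {K : Type*} [Field K] (v : Valuation K ℝ≥0)
    (hv : ∃ c : K, v c ≠ 0 ∧ v c < 1) :
    ∃ u : Valuation (AlgebraicClosure K) ℝ≥0,
      ∀ x : K, u (algebraMap K (AlgebraicClosure K) x) = v x := by
  let a : AbsoluteValue K ℝ :=
    { toFun := fun x => v x
      map_mul' := by simp
      nonneg' := by simp
      eq_zero' := by simp
      add_le' := fun x y => by
        have h := v.map_add x y
        have h' : v (x + y) ≤ v x + v y := h.trans (max_le_add_of_nonneg zero_le zero_le)
        exact_mod_cast h' }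
  have hnorm : ∀ x : WithAbs a, ‖x‖ = v x.ofAbs := fun x => rfl
  have : IsUltrametricDist (WithAbs a) :=
    IsUltrametricDist.isUltrametricDist_of_forall_norm_add_le_max_norm fun x y => by
      rw [hnorm, hnorm, hnorm]
      exact_mod_cast v.map_add x.ofAbs y.ofAbs
  have := isUltrametricDist_completion (WithAbs a)
  obtain ⟨c, hc0, hc1⟩ := hv
  let _ : NontriviallyNormedField (Completion (WithAbs a)) :=
    { (inferInstance : NormedField (Completion (WithAbs a))) with
      non_trivial := by
        refine ⟨((WithAbs.toAbs a c⁻¹ : WithAbs a) : Completion (WithAbs a)), ?_⟩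
        rw [Completion.norm_coe, hnorm]
        have : 1 < v c⁻¹ := by
          rw [map_inv₀]
          exact (one_lt_inv₀ (pos_iff_ne_zero.2 hc0)).2 hc1
        exact_mod_cast this }
  -- The spectral norm is multiplicative over a complete base, hence the detour through the
  -- completion; the resulting valuation is pulled back along an embedding of algebraic closures.
  let i : K →+* Completion (WithAbs a) :=
    (Completion.coeRingHom (α := WithAbs a)).comp (WithAbs.equiv a).symm.toRingHom
  let C := AlgebraicClosure (Completion (WithAbs a))
  let f := spectralMulAlgNorm (Completion (WithAbs a)) C
  let j : K →+* C := (algebraMap (Completion (WithAbs a)) C).comp i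
  let _ : Algebra K C := j.toAlgebra
  let l : AlgebraicClosure K →ₐ[K] C := IsAlgClosed.lift
  refine ⟨(valuationOfMulAlgebraNorm f isNonarchimedean_spectralNorm).comap l, fun x => ?_⟩
  rw [Valuation.comap_apply]
  have : (l : AlgebraicClosure K →+* C) (algebraMap K (AlgebraicClosure K) x)
      = algebraMap (Completion (WithAbs a)) C (i x) := l.commutes x
  rw [this]
  ext
  have h := spectralNorm_extends (L := C) (i x)
  refine h.trans ?_
  change ‖((WithAbs.toAbs a x : WithAbs a) : Completion (WithAbs a))‖ = _
  rw [Completion.norm_coe, hnorm]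

end Extension

/-! ### Density of the value group -/

section Dense

variable {K : Type*} [Field K] {v : Valuation K ℝ≥0}

lemma exists_ne_zero_lt_one (hrank : ringKrullDim v.valuationSubring = 1) :
    ∃ c : K, v c ≠ 0 ∧ v c < 1 := by
  by_contra! h
  have hF : IsField v.valuationSubring := by
    refine ⟨⟨0, 1, zero_ne_one⟩, mul_comm, fun {a} ha => ?_⟩
    have ha' : v (a : K) ≠ 0 := by simpa using ha
    have hmem : (a : K)⁻¹ ∈ v.valuationSubring := by
      rw [Valuation.mem_valuationSubring_iff, map_inv₀]
      exact inv_le_one_of_one_le₀ (h _ ha')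
    refine ⟨⟨_, hmem⟩, ?_⟩
    ext
    exact mul_inv_cancel₀ (by simpa using ha)
  rw [ringKrullDim_eq_zero_of_isField hF] at hrank
  exact zero_ne_one hrank

lemma denselyOrdered_range (hrank : ringKrullDim v.valuationSubring = 1)
    (hdisc : ¬ IsDiscreteValuationRing v.valuationSubring) :
    DenselyOrdered (Set.range v) := by
  by_contra h
  have : MulArchimedean (MonoidHom.mrange v) :=
    MulArchimedean.comap (MonoidHom.mrange v).subtype (Subtype.strictMono_coe _)
  have hp : IsPrincipalIdealRing v.valuationSubring :=
    (Valuation.Integers.isPrincipalIdealRing_iff_not_denselyOrdered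
      (Valuation.integer.integers v)).2 h
  refine hdisc ?_
  refine { hp with not_a_field' := fun hm => ?_ }
  have hF : IsField v.valuationSubring := IsLocalRing.isField_iff_maximalIdeal_eq.2 hm
  rw [ringKrullDim_eq_zero_of_isField hF] at hrank
  exact zero_ne_one hrank

/-- A densely ordered nontrivial value group contained in `ℝ` is dense. -/
lemma exists_between_of_denselyOrdered (hc : ∃ c : K, v c ≠ 0 ∧ v c < 1)
    (hd : DenselyOrdered (Set.range v)) {x y : ℝ≥0} (hxy : x < y) :
    ∃ c : K, x < v c ∧ v c < y := by
  -- It is enough to find values arbitrarily close to 1 from below: their powers then form geometric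
  -- progressions of ratio close to 1.
  have key : ∀ x : ℝ≥0, x < 1 → ∃ c : K, x < v c ∧ v c < 1 := by
    by_contra! h
    obtain ⟨x, hx1, hx⟩ := h
    obtain ⟨c₀, hc₀, hc₁⟩ := hc
    let S : Set ℝ≥0 := {r | ∃ c : K, v c = r ∧ r < 1}
    have hne : S.Nonempty := ⟨_, c₀, rfl, hc₁⟩
    have hbd : BddAbove S := ⟨1, fun r ⟨_, _, h⟩ => h.le⟩
    have hle : ∀ c : K, v c < 1 → v c ≤ x := fun c hc => by
      by_contra! h'
      exact absurd hc (hx c h').not_gt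
    have hσ1 : sSup S < 1 := by
      refine (csSup_le hne ?_).trans_lt hx1
      rintro r ⟨c, rfl, h⟩
      exact hle c h
    have hσ0 : 0 < sSup S := (pos_iff_ne_zero.2 hc₀).trans_le (le_csSup hbd ⟨c₀, rfl, hc₁⟩)
    have hmax : ∀ c : K, v c < 1 → v c ≤ sSup S := fun c h => le_csSup hbd ⟨c, rfl, h⟩
    have hnot : ∀ c : K, v c = sSup S → False := fun c h => by
      obtain ⟨⟨_, d, rfl⟩, h1, h2⟩ :=
        hd.dense (⟨v c, c, rfl⟩ : Set.range v) ⟨1, 1, map_one v⟩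
          (show v c < 1 from h ▸ hσ1)
      rw [← Subtype.coe_lt_coe] at h1 h2
      exact absurd (hmax d h2) (not_le.2 (h ▸ h1))
    -- The supremum σ of the values below 1 is not attained. Two distinct values in (σ², σ) have a
    -- quotient strictly between σ and 1, a contradiction.
    obtain ⟨_, ⟨a, rfl, ha1⟩, ha⟩ := exists_lt_of_lt_csSup hne
      (show sSup S * sSup S < sSup S from mul_lt_of_lt_one_left hσ0 hσ1)
    have haσ : v a < sSup S := lt_of_le_of_ne (hmax a ha1) (hnot a)
    obtain ⟨_, ⟨b, rfl, hb1⟩, hb⟩ := exists_lt_of_lt_csSup hne haσ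
    have hb0 : 0 < v b := zero_le.trans_lt hb
    have h1 : v (a / b) < 1 := by
      rw [map_div₀]
      exact (div_lt_one hb0).2 hb
    have h2 : sSup S < v (a / b) := by
      rw [map_div₀, lt_div_iff₀ hb0]
      exact (mul_le_mul_right (hmax b hb1) _).trans_lt ha
    exact absurd (hmax _ h1) h2.not_ge
  have hy : 0 < y := zero_le.trans_lt hxy
  obtain ⟨g, hg, hg1⟩ := key (x / y) ((div_lt_one hy).2 hxy)
  have hg0 : 0 < v g := zero_le.trans_lt hg
  obtain ⟨n, hn1, hn2⟩ := exists_mem_Ioc_zpow hy ((one_lt_inv₀ hg0).2 hg1)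
  refine ⟨g⁻¹ ^ n, ?_, by simpa using hn1⟩
  rw [map_zpow₀, map_inv₀]
  rw [zpow_add_one₀ (inv_ne_zero hg0.ne'), ← div_eq_mul_inv, le_div_iff₀ hg0] at hn2
  exact ((div_lt_iff₀' hy).1 hg).trans_le hn2

end Dense

/-! ### Commensurability with the value group -/

section Commensurable

variable {K : Type*} [Field K]

/-- A nonnegative real number is commensurable with the value group of `v` if one of its positive
powers is a value of `v`. -/
def IsCommensurable (v : Valuation K ℝ≥0) (x : ℝ≥0) : Prop :=
  ∃ n : ℕ, n ≠ 0 ∧ ∃ c : K, x ^ n = v c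

variable {v : Valuation K ℝ≥0} {x y : ℝ≥0}

namespace IsCommensurable

lemma of_value (c : K) : IsCommensurable v (v c) := ⟨1, one_ne_zero, c, pow_one _⟩

lemma mul (hx : IsCommensurable v x) (hy : IsCommensurable v y) : IsCommensurable v (x * y) := by
  obtain ⟨n, hn, c, hc⟩ := hx
  obtain ⟨m, hm, d, hd⟩ := hy
  refine ⟨n * m, mul_ne_zero hn hm, c ^ m * d ^ n, ?_⟩
  rw [mul_pow, map_mul, map_pow, map_pow, ← hc, ← hd, ← pow_mul, ← pow_mul, mul_comm m n]

lemma inv (hx : IsCommensurable v x) : IsCommensurable v x⁻¹ := by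
  obtain ⟨n, hn, c, hc⟩ := hx
  exact ⟨n, hn, c⁻¹, by rw [inv_pow, hc, map_inv₀]⟩

lemma div (hx : IsCommensurable v x) (hy : IsCommensurable v y) : IsCommensurable v (x / y) := by
  rw [div_eq_mul_inv]
  exact hx.mul hy.inv

lemma multiset_prod {M : Multiset ℝ≥0} (h : ∀ x ∈ M, IsCommensurable v x) :
    IsCommensurable v M.prod := by
  induction M using Multiset.induction_on with
  | empty => exact ⟨1, one_ne_zero, 1, by simp⟩
  | cons a M ih =>
    rw [Multiset.prod_cons]
    exact (h a (Multiset.mem_cons_self a M)).mul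
      (ih fun x hx => h x (Multiset.mem_cons_of_mem hx))

lemma of_pow {n : ℕ} (hn : n ≠ 0) (h : IsCommensurable v (x ^ n)) : IsCommensurable v x := by
  obtain ⟨m, hm, c, hc⟩ := h
  exact ⟨n * m, mul_ne_zero hn hm, c, by rw [pow_mul, hc]⟩

lemma of_zpow {n : ℤ} (hn : n ≠ 0) (h : IsCommensurable v (x ^ n)) : IsCommensurable v x := by
  obtain ⟨k, rfl | rfl⟩ := n.eq_nat_or_neg
  · rw [zpow_natCast] at h
    exact h.of_pow (by simpa using hn)
  · rw [zpow_neg, zpow_natCast] at h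
    have := h.inv
    rw [inv_inv] at this
    exact this.of_pow (by simpa using hn)

/-- The value group of an algebraic extension is commensurable with that of the base field. -/
lemma of_algebraic {C : Type*} [Field C] [Algebra K C] {u : Valuation C ℝ≥0}
    (hu : ∀ x : K, u (algebraMap K C x) = v x) {α : C} (hα : IsAlgebraic K α) :
    IsCommensurable v (u α) := by
  rcases eq_or_ne α 0 with rfl | hα0
  · exact ⟨1, one_ne_zero, 0, by simp⟩
  obtain ⟨p, hp, hpα⟩ := hα
  have hux : u α ≠ 0 := (Valuation.ne_zero_iff u).2 hα0
  obtain ⟨i, hi, hmax⟩ := p.support.exists_max_image (fun j => v (p.coeff j) * u α ^ j)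
    (Polynomial.support_nonempty.2 hp)
  have hci : v (p.coeff i) ≠ 0 := (Valuation.ne_zero_iff v).2 (Polynomial.mem_support_iff.1 hi)
  have hterm : ∀ j, u (algebraMap K C (p.coeff j) * α ^ j) = v (p.coeff j) * u α ^ j := fun j => by
    rw [map_mul, hu, map_pow]
  -- A unique term of maximal value would dominate the sum, which vanishes; two terms of equal value
  -- express a nonzero power of `u α` as a value of `v`.
  obtain ⟨j, hj, hji, hval⟩ : ∃ j ∈ p.support, j ≠ i ∧
      v (p.coeff j) * u α ^ j = v (p.coeff i) * u α ^ i := by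
    by_contra! h
    have hsum : u (∑ j ∈ p.support.erase i, algebraMap K C (p.coeff j) * α ^ j)
        < v (p.coeff i) * u α ^ i := by
      refine Valuation.map_sum_lt u (mul_ne_zero hci (pow_ne_zero _ hux)) fun j hj => ?_
      rw [Finset.mem_erase] at hj
      rw [hterm]
      exact lt_of_le_of_ne (hmax j hj.2) (h j hj.2 hj.1)
    rw [Polynomial.aeval_eq_sum_range, ← Polynomial.sum_over_range' p (by simp) _ (Nat.lt_succ_self _)
      (f := fun j a => a • α ^ j), Polynomial.sum] at hpα
    simp only [Algebra.smul_def] at hpα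
    rw [← Finset.add_sum_erase _ _ hi] at hpα
    rw [← hterm, ← neg_eq_of_add_eq_zero_right hpα, Valuation.map_neg] at hsum
    exact lt_irrefl _ hsum
  have hcj : v (p.coeff j) ≠ 0 := (Valuation.ne_zero_iff v).2 (Polynomial.mem_support_iff.1 hj)
  refine of_zpow (n := (j : ℤ) - i) (sub_ne_zero.2 (by exact_mod_cast hji)) ?_
  refine ⟨1, one_ne_zero, p.coeff i / p.coeff j, ?_⟩
  rw [pow_one, zpow_sub₀ hux, zpow_natCast, zpow_natCast, map_div₀,
    div_eq_div_iff (pow_ne_zero _ hux) hcj, mul_comm, hval]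

end IsCommensurable

end Commensurable

/-! ### Pseudo-convergent sequences and pseudo-limits -/

section Sequence

variable {K : Type*} [Field K]

/-- The values of the successive differences of a sequence. -/
noncomputable def gap (v : Valuation K ℝ≥0) (s : ℕ → K) (n : ℕ) : ℝ≥0 := v (s (n + 1) - s n)

variable {v : Valuation K ℝ≥0} {s : ℕ → K}

namespace IsPseudoConvergent

lemma strictAnti_gap (hs : IsPseudoConvergent v s) : StrictAnti (gap v s) :=
  strictAnti_nat_of_succ_lt hs

lemma gap_pos (hs : IsPseudoConvergent v s) (n : ℕ) : 0 < gap v s n :=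
  zero_le.trans_lt (hs.strictAnti_gap n.lt_succ_self)

lemma map_sub (hs : IsPseudoConvergent v s) {n m : ℕ} (h : n < m) :
    v (s m - s n) = gap v s n := by
  induction m, h using Nat.le_induction with
  | base => rfl
  | succ m hm ih =>
    rw [← sub_add_sub_cancel _ (s m), Valuation.map_add_eq_of_lt_right, ih]
    rw [ih]
    exact hs.strictAnti_gap hm

lemma injective (hs : IsPseudoConvergent v s) : Function.Injective s := by
  have key : ∀ n m, n < m → s n ≠ s m := fun n m h e => by
    have := hs.map_sub h
    rw [e, sub_self, map_zero] at this
    exact (hs.gap_pos n).ne this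
  intro n m h
  rcases lt_trichotomy n m with h' | h' | h'
  · exact absurd h (key n m h')
  · exact h'
  · exact absurd h.symm (key m n h')

lemma eventually_eval_ne_zero (hs : IsPseudoConvergent v s) {p : Polynomial K} (hp : p ≠ 0) :
    ∀ᶠ n in atTop, p.eval (s n) ≠ 0 := by
  have h := hs.injective.tendsto_cofinite.eventually
    (p.rootSet_finite K).eventually_cofinite_notMem
  rw [Nat.cofinite_eq_atTop] at h
  filter_upwards [h] with n hn h0
  exact hn (by rw [Polynomial.mem_rootSet]; exact ⟨hp, by simpa using h0⟩)

end IsPseudoConvergent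

variable {C : Type*} [Field C] [Algebra K C] {u : Valuation C ℝ≥0}

/-- `α` is a pseudo-limit of the sequence `s`. -/
def IsPseudoLimit (v : Valuation K ℝ≥0) (u : Valuation C ℝ≥0) (s : ℕ → K) (α : C) : Prop :=
  ∀ n, u (algebraMap K C (s n) - α) = gap v s n

/-- If every distance to α were at most the gap, the distance at `n + 1` would be below the gap at
`n`, forcing equality at `n`. So some distance exceeds its gap, and later terms move by too little
to change it. -/
lemma IsPseudoConvergent.eventually_of_not_isPseudoLimit (hs : IsPseudoConvergent v s)
    (hu : ∀ x : K, u (algebraMap K C x) = v x) {α : C} (hα : ¬ IsPseudoLimit v u s α) :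
    ∃ c : ℝ≥0, ∃ N, ∀ n ≥ N, u (algebraMap K C (s n) - α) = c ∧ gap v s n < c := by
  have key : ∃ N, gap v s N < u (algebraMap K C (s N) - α) := by
    by_contra! h
    refine hα fun n => ?_
    have h1 : u (algebraMap K C (s (n + 1)) - α) < gap v s n :=
      (h (n + 1)).trans_lt (hs.strictAnti_gap n.lt_succ_self)
    have h2 : u (algebraMap K C (s n) - algebraMap K C (s (n + 1))) = gap v s n := by
      rw [← _root_.map_sub, hu, Valuation.map_sub_swap, gap]
    rw [← sub_add_sub_cancel _ (algebraMap K C (s (n + 1))), Valuation.map_add_eq_of_lt_left, h2]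
    rwa [h2]
  obtain ⟨N, hN⟩ := key
  refine ⟨u (algebraMap K C (s N) - α), N, fun n hn => ?_⟩
  refine ⟨?_, (hs.strictAnti_gap.antitone hn).trans_lt hN⟩
  rcases hn.eq_or_lt with rfl | hlt
  · rfl
  · rw [← sub_add_sub_cancel _ (algebraMap K C (s N)), Valuation.map_add_eq_of_lt_right]
    rwa [← _root_.map_sub, hu, hs.map_sub hlt]

open Classical in
/-- The roots of `p` that are pseudo-limits of `s`, with multiplicity. -/
noncomputable def limitRoots (v : Valuation K ℝ≥0) (u : Valuation C ℝ≥0) (s : ℕ → K)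
    (p : Polynomial K) : Multiset C :=
  (p.aroots C).filter (IsPseudoLimit v u s)

lemma isPseudoLimit_of_mem_limitRoots {p : Polynomial K} {α : C} (h : α ∈ limitRoots v u s p) :
    IsPseudoLimit v u s α := by
  classical
  rw [limitRoots, Multiset.mem_filter] at h
  exact h.2

/-- The value of a polynomial near a late term of `s`, in terms of the distances to
the roots that are pseudo-limits. -/
lemma IsPseudoConvergent.eventually_local [IsAlgClosed C] [Algebra.IsAlgebraic K C]
    (hs : IsPseudoConvergent v s) (hu : ∀ x : K, u (algebraMap K C x) = v x)
    {p : Polynomial K} (hp : p ≠ 0) :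
    ∀ᶠ N in atTop, ∃ γ : ℝ≥0, γ ≠ 0 ∧ IsCommensurable v γ ∧
      ∀ t : K, v (t - s (N + 1)) < gap v s N →
        v (p.eval t) =
          γ * ((limitRoots v u s p).map fun α => u (algebraMap K C t - α)).prod := by
  classical
  -- For late `N` the roots that are not pseudo-limits lie at distance greater than the gap from `s
  -- (N + 1)`, so their distance is constant on the ball considered. Those distances and the leading
  -- coefficient make up γ.
  have h1 : ∀ᶠ N in atTop, ∀ β ∈ (p.aroots C).toFinset, ¬ IsPseudoLimit v u s β →
      gap v s N < u (algebraMap K C (s (N + 1)) - β) := by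
    rw [Filter.eventually_all_finset]
    intro β _
    by_cases hβ : IsPseudoLimit v u s β
    · exact Eventually.of_forall fun _ h => absurd hβ h
    obtain ⟨c, M, hM⟩ := hs.eventually_of_not_isPseudoLimit hu hβ
    filter_upwards [eventually_ge_atTop M] with N hN _
    rw [(hM (N + 1) (by omega)).1]
    exact (hM N hN).2
  filter_upwards [h1] with N hN
  have hev : ∀ t : K, v (p.eval t) = v p.leadingCoeff *
      ((p.aroots C).map fun α => u (algebraMap K C t - α)).prod := fun t => by
    have hsplit := (IsAlgClosed.splits (p.map (algebraMap K C))).eq_prod_roots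
    have h := congrArg (Polynomial.eval (algebraMap K C t)) hsplit
    rw [Polynomial.eval_map, Polynomial.eval₂_at_apply, Polynomial.eval_mul,
      Polynomial.eval_C, Polynomial.eval_multiset_prod, Polynomial.leadingCoeff_map] at h
    rw [← hu, h, map_mul, hu, map_multiset_prod, Multiset.map_map, Multiset.map_map]
    simp [Function.comp_def, Polynomial.aroots]
  have hlc : v p.leadingCoeff ≠ 0 :=
    (Valuation.ne_zero_iff v).2 (Polynomial.leadingCoeff_ne_zero.2 hp)
  let M := ((p.aroots C).filter fun β => ¬ IsPseudoLimit v u s β).map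
    fun β => u (algebraMap K C (s (N + 1)) - β)
  refine ⟨v p.leadingCoeff * M.prod, mul_ne_zero hlc ?_, (IsCommensurable.of_value _).mul ?_, ?_⟩
  · refine Multiset.prod_ne_zero fun h0 => ?_
    obtain ⟨β, hβ, h0⟩ := Multiset.mem_map.1 h0
    rw [Multiset.mem_filter] at hβ
    have := hN β (Multiset.mem_toFinset.2 hβ.1) hβ.2
    rw [h0] at this
    exact not_lt_zero this
  · refine IsCommensurable.multiset_prod fun x hx => ?_
    obtain ⟨β, -, rfl⟩ := Multiset.mem_map.1 hx
    exact IsCommensurable.of_algebraic hu (Algebra.IsAlgebraic.isAlgebraic _)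
  · intro t ht
    rw [hev, mul_assoc, ← Multiset.filter_add_not (IsPseudoLimit v u s) (p.aroots C),
      Multiset.map_add, Multiset.prod_add, mul_comm (Multiset.prod _)]
    congr 2
    refine congrArg _ (Multiset.map_congr rfl fun β hβ => ?_)
    rw [Multiset.mem_filter] at hβ
    have h2 := hN β (Multiset.mem_toFinset.2 hβ.1) hβ.2
    rw [← sub_add_sub_cancel _ (algebraMap K C (s (N + 1))), Valuation.map_add_eq_of_lt_right]
    rw [← _root_.map_sub, hu]
    exact ht.trans h2

lemma IsPseudoConvergent.map_sub_lt (hs : IsPseudoConvergent v s) {n N : ℕ} (h : N < n) :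
    v (s n - s (N + 1)) < gap v s N := by
  rcases (Nat.succ_le_of_lt h).eq_or_lt with rfl | h
  · simpa using hs.gap_pos N
  · rw [hs.map_sub h]
    exact hs.strictAnti_gap N.lt_succ_self

lemma limitRoots_prod {p : Polynomial K} (n : ℕ) :
    ((limitRoots v u s p).map fun α => u (algebraMap K C (s n) - α)).prod =
      gap v s n ^ Multiset.card (limitRoots v u s p) := by
  rw [Multiset.map_congr rfl fun α hα => isPseudoLimit_of_mem_limitRoots hα n,
    Multiset.map_const', Multiset.prod_replicate]

end Sequence

/-! ### Monotonicity of powers of the gap -/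

section StrictAntiPowers

variable {g : ℕ → ℝ≥0}

lemma strictAnti_mul_zpow (hg : StrictAnti g) {γ : ℝ≥0} (hγ : γ ≠ 0) {k : ℤ}
    (hk : 0 < k) : StrictAnti fun n => γ * g n ^ k := fun _ _ h =>
  mul_lt_mul_of_pos_left (zpow_lt_zpow_left₀ hk zero_le (hg h)) (pos_iff_ne_zero.2 hγ)

lemma monotone_mul_zpow (hg : StrictAnti g) (h0 : ∀ n, 0 < g n) (γ : ℝ≥0) {k : ℤ} (hk : k ≤ 0) :
    Monotone fun n => γ * g n ^ k := fun m n h => by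
  have h1 : (g m)⁻¹ ^ (-k) ≤ (g n)⁻¹ ^ (-k) :=
    zpow_le_zpow_left₀ (neg_nonneg.2 hk) zero_le (inv_anti₀ (h0 n) (hg.antitone h))
  rw [inv_zpow', inv_zpow', neg_neg] at h1
  exact mul_le_mul_right h1 γ

lemma eventually_le_one_or_one_le {f : ℕ → ℝ≥0} (hf : Monotone f ∨ Antitone f) :
    (∀ᶠ n in atTop, f n ≤ 1) ∨ ∀ᶠ n in atTop, 1 ≤ f n := by
  rcases hf with hf | hf
  · by_cases h : ∃ N, 1 ≤ f N
    · obtain ⟨N, hN⟩ := h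
      exact Or.inr (eventually_atTop.2 ⟨N, fun n hn => hN.trans (hf hn)⟩)
    · push Not at h
      exact Or.inl (Eventually.of_forall fun n => (h n).le)
  · by_cases h : ∃ N, f N ≤ 1
    · obtain ⟨N, hN⟩ := h
      exact Or.inl (eventually_atTop.2 ⟨N, fun n hn => (hf hn).trans hN⟩)
    · push Not at h
      exact Or.inr (Eventually.of_forall fun n => (h n).le)

end StrictAntiPowers

/-! ### Values of rational functions, and the relation between V_E and W_E -/

section RationalFunctions

variable {K : Type*} [Field K] {v : Valuation K ℝ≥0} {s t : ℕ → K}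
  {C : Type*} [Field C] [Algebra K C] {u : Valuation C ℝ≥0}

lemma eval_id (φ : RatFunc K) (x : K) :
    φ.eval (RingHom.id K) x = φ.num.eval x / φ.denom.eval x := by
  rw [RatFunc.eval, Polynomial.eval₂_id, Polynomial.eval₂_id]

/-- The number of zeros minus the number of poles of `φ` that are pseudo-limits of `s`. -/
noncomputable def limitOrder (v : Valuation K ℝ≥0) (u : Valuation C ℝ≥0) (s : ℕ → K)
    (φ : RatFunc K) : ℤ :=
  Multiset.card (limitRoots v u s φ.num) - Multiset.card (limitRoots v u s φ.denom)

namespace IsPseudoConvergent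

lemma tendsto_gap (hs : IsPseudoConvergent v s) :
    Tendsto (gap v s) atTop (𝓝 (⨅ n, gap v s n)) :=
  tendsto_atTop_ciInf hs.strictAnti_gap.antitone (OrderBot.bddBelow _)

lemma eventually_denom_ne_zero (hs : IsPseudoConvergent v s) (φ : RatFunc K) :
    ∀ᶠ n in atTop, φ.denom.eval (s n) ≠ 0 :=
  hs.eventually_eval_ne_zero φ.denom_ne_zero

lemma mem_VE_iff (hs : IsPseudoConvergent v s) (φ : RatFunc K) :
    φ ∈ VE v s ↔ ∀ᶠ n in atTop, v (φ.eval (RingHom.id K) (s n)) ≤ 1 := by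
  constructor
  · intro h
    filter_upwards [h] with n hn using hn.2
  · intro h
    filter_upwards [h, hs.eventually_denom_ne_zero φ] with n hn h0 using ⟨h0, hn⟩

lemma eventually_eval_add (hs : IsPseudoConvergent v s) (φ ψ : RatFunc K) :
    ∀ᶠ n in atTop, (φ + ψ).eval (RingHom.id K) (s n) =
      φ.eval (RingHom.id K) (s n) + ψ.eval (RingHom.id K) (s n) := by
  filter_upwards [hs.eventually_denom_ne_zero φ, hs.eventually_denom_ne_zero ψ] with n h1 h2
  exact RatFunc.eval_add _ _ (by rwa [Polynomial.eval₂_id]) (by rwa [Polynomial.eval₂_id])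

lemma eventually_eval_mul (hs : IsPseudoConvergent v s) (φ ψ : RatFunc K) :
    ∀ᶠ n in atTop, (φ * ψ).eval (RingHom.id K) (s n) =
      φ.eval (RingHom.id K) (s n) * ψ.eval (RingHom.id K) (s n) := by
  filter_upwards [hs.eventually_denom_ne_zero φ, hs.eventually_denom_ne_zero ψ] with n h1 h2
  exact RatFunc.eval_mul _ _ (by rwa [Polynomial.eval₂_id]) (by rwa [Polynomial.eval₂_id])

variable [IsAlgClosed C] [Algebra.IsAlgebraic K C]

lemma eventually_eval_polynomial (hs : IsPseudoConvergent v s)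
    (hu : ∀ x : K, u (algebraMap K C x) = v x) {p : Polynomial K} (hp : p ≠ 0) :
    ∃ γ : ℝ≥0, γ ≠ 0 ∧ ∀ᶠ n in atTop,
      v (p.eval (s n)) = γ * gap v s n ^ Multiset.card (limitRoots v u s p) := by
  obtain ⟨N, γ, hγ, -, h⟩ := (hs.eventually_local (u := u) hu hp).exists
  refine ⟨γ, hγ, ?_⟩
  filter_upwards [eventually_gt_atTop N] with n hn
  rw [h _ (hs.map_sub_lt hn), limitRoots_prod]

lemma eventually_eval (hs : IsPseudoConvergent v s)
    (hu : ∀ x : K, u (algebraMap K C x) = v x) {φ : RatFunc K} (hφ : φ ≠ 0) :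
    ∃ γ : ℝ≥0, γ ≠ 0 ∧ ∀ᶠ n in atTop,
      v (φ.eval (RingHom.id K) (s n)) = γ * gap v s n ^ limitOrder v u s φ := by
  obtain ⟨γ, hγ, h1⟩ := hs.eventually_eval_polynomial (u := u) hu (RatFunc.num_ne_zero hφ)
  obtain ⟨γ', hγ', h2⟩ := hs.eventually_eval_polynomial (u := u) hu φ.denom_ne_zero
  refine ⟨γ / γ', div_ne_zero hγ hγ', ?_⟩
  filter_upwards [h1, h2] with n h1 h2
  rw [eval_id, map_div₀, h1, h2, limitOrder, zpow_sub₀ (hs.gap_pos n).ne', zpow_natCast,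
    zpow_natCast, div_mul_div_comm]

/-- The valuation domain `V_E`. -/
def ringVE (hs : IsPseudoConvergent v s) (hu : ∀ x : K, u (algebraMap K C x) = v x) :
    ValuationSubring (RatFunc K) where
  carrier := VE v s
  mul_mem' {φ ψ} h1 h2 := by
    rw [hs.mem_VE_iff] at *
    filter_upwards [h1, h2, hs.eventually_eval_mul φ ψ] with n h1 h2 h
    rw [h, map_mul]
    exact mul_le_one' h1 h2
  one_mem' := by
    rw [hs.mem_VE_iff]
    simp
  add_mem' {φ ψ} h1 h2 := by
    rw [hs.mem_VE_iff] at *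
    filter_upwards [h1, h2, hs.eventually_eval_add φ ψ] with n h1 h2 h
    rw [h]
    exact v.map_add_le h1 h2
  zero_mem' := by
    rw [hs.mem_VE_iff]
    simp
  neg_mem' {φ} h1 := by
    rw [hs.mem_VE_iff] at *
    filter_upwards [h1, hs.eventually_eval_mul (RatFunc.C (-1)) φ] with n h1 h
    have e : -φ = RatFunc.C (-1) * φ := by simp
    rw [e, h, map_mul, RatFunc.eval_C]
    simpa using h1
  mem_or_inv_mem' φ := by
    rcases eq_or_ne φ 0 with rfl | hφ
    · left
      rw [hs.mem_VE_iff]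
      simp
    obtain ⟨γ, hγ, h⟩ := hs.eventually_eval (u := u) hu hφ
    have hmono : Monotone (fun n => γ * gap v s n ^ limitOrder v u s φ) ∨
        Antitone fun n => γ * gap v s n ^ limitOrder v u s φ := by
      rcases le_or_gt (limitOrder v u s φ) 0 with hk | hk
      · exact Or.inl (monotone_mul_zpow hs.strictAnti_gap hs.gap_pos γ hk)
      · exact Or.inr (strictAnti_mul_zpow hs.strictAnti_gap hγ hk).antitone
    rcases eventually_le_one_or_one_le hmono with h' | h'
    · left
      rw [hs.mem_VE_iff]
      filter_upwards [h, h'] with n h h'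
      exact h.trans_le h'
    · right
      rw [hs.mem_VE_iff]
      filter_upwards [h, h', hs.eventually_eval_mul φ φ⁻¹] with n h h' hmul
      rw [mul_inv_cancel₀ hφ, RatFunc.eval_one] at hmul
      have h1 := congrArg v hmul
      rw [map_one, map_mul, h] at h1
      rw [eq_inv_of_mul_eq_one_right h1.symm]
      exact inv_le_one_of_one_le₀ h'

/-- The valuation domain `V_E` as a point of `𝒱`. -/
def pointV (hs : IsPseudoConvergent v s) (hu : ∀ x : K, u (algebraMap K C x) = v x) :
    spaceV v :=
  ⟨⟨hs.ringVE hu, fun d => by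
    change _ ∈ VE v s
    rw [hs.mem_VE_iff]
    refine Eventually.of_forall fun n => ?_
    have : algebraMap v.valuationSubring (RatFunc K) d = RatFunc.C (d : K) := rfl
    rw [this, RatFunc.eval_C]
    exact d.2⟩, s, hs, rfl⟩

end IsPseudoConvergent

namespace IsOstrowskiValuation

variable {w : Valuation (RatFunc K) ℝ≥0}

lemma map_C (hw : IsOstrowskiValuation v s w) (c : K) : w (RatFunc.C c) = v c := by
  have h := hw (RatFunc.C c)
  simp only [RatFunc.eval_C, RingHom.id_apply] at h
  exact tendsto_nhds_unique h tendsto_const_nhds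

lemma tendsto_sub (hw : IsOstrowskiValuation v s w) (c : K) :
    Tendsto (fun n => v (s n - c)) atTop (𝓝 (w (algebraMap _ _ (Polynomial.X - Polynomial.C c)))) := by
  refine (hw _).congr fun n => ?_
  rw [RatFunc.eval_algebraMap]
  simp

/-- `φ ∈ V_E` in terms of the valuation `w_E` and the limit order of `φ`. -/
lemma mem_VE_iff [IsAlgClosed C] [Algebra.IsAlgebraic K C] (hs : IsPseudoConvergent v s)
    (hu : ∀ x : K, u (algebraMap K C x) = v x)
    (hw : IsOstrowskiValuation v s w) (φ : RatFunc K) :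
    φ ∈ VE v s ↔ w φ < 1 ∨ w φ = 1 ∧ limitOrder v u s φ ≤ 0 := by
  rw [hs.mem_VE_iff]
  rcases lt_trichotomy (w φ) 1 with h | h | h
  · simp only [h, true_or, iff_true]
    filter_upwards [(hw φ).eventually (gt_mem_nhds h)] with n hn using hn.le
  · have hφ : φ ≠ 0 := by
      rintro rfl
      simp at h
    obtain ⟨γ, hγ, hev⟩ := hs.eventually_eval (u := u) hu hφ
    have hlim := (hw φ).congr' hev
    rw [h] at hlim
    simp only [h, lt_irrefl, true_and, false_or]
    -- The values γ · (gap)^k tend to 1: from below, weakly, if k ≤ 0, and strictly from above if k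
    -- > 0.
    rcases le_or_gt (limitOrder v u s φ) 0 with hk | hk
    · simp only [hk, iff_true]
      filter_upwards [hev] with n hn
      rw [hn]
      exact (monotone_mul_zpow hs.strictAnti_gap hs.gap_pos γ hk).ge_of_tendsto hlim n
    · simp only [hk.not_ge, iff_false]
      intro h'
      have hanti := strictAnti_mul_zpow hs.strictAnti_gap hγ hk
      obtain ⟨n, h1, h2⟩ := (hev.and h').exists
      have h3 := hanti.antitone.le_of_tendsto hlim (n + 1)
      rw [h1] at h2
      exact absurd h2 (not_le.2 (h3.trans_lt (hanti n.lt_succ_self)))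
  · simp only [h.not_gt, h.ne', false_and, or_false, iff_false]
    intro h'
    obtain ⟨n, h1, h2⟩ := ((hw φ).eventually (lt_mem_nhds h)).and h' |>.exists
    exact absurd h2 h1.not_ge

/-- The pseudo-limits of `E` are determined by `w_E`. -/
lemma isPseudoLimit (hs : IsPseudoConvergent v s) (ht : IsPseudoConvergent v t)
    (hu : ∀ x : K, u (algebraMap K C x) = v x)
    (hws : IsOstrowskiValuation v s w) (hwt : IsOstrowskiValuation v t w) {α : C}
    (hα : IsPseudoLimit v u s α) : IsPseudoLimit v u t α := by
  -- Both sequences compute w(X - t n), so the terms of `s` approach `t n` to the same limiting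
  -- distance as the terms of `t`.
  have hlim : ∀ n, Tendsto (fun m => v (s m - t n)) atTop (𝓝 (gap v t n)) := fun n => by
    have h1 := hwt.tendsto_sub (t n)
    have h2 : Tendsto (fun m => v (t m - t n)) atTop (𝓝 (gap v t n)) := by
      refine tendsto_const_nhds.congr' ?_
      filter_upwards [eventually_gt_atTop n] with m hm
      rw [ht.map_sub hm]
    rw [← tendsto_nhds_unique h1 h2]
    exact hws.tendsto_sub (t n)
  have hle : ∀ n, (⨅ m, gap v s m) ≤ gap v t n := fun n => by
    by_cases h : IsPseudoLimit v u s (algebraMap K C (t n))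
    · refine (tendsto_nhds_unique (hlim n) (hs.tendsto_gap.congr fun m => ?_)).ge
      rw [← h m, ← map_sub, hu]
    · obtain ⟨c, N, hN⟩ := hs.eventually_of_not_isPseudoLimit hu h
      have h2 : gap v t n = c := by
        refine tendsto_nhds_unique (hlim n) (tendsto_const_nhds.congr' ?_)
        filter_upwards [eventually_ge_atTop N] with m hm
        rw [← (hN m hm).1, ← map_sub, hu]
      rw [h2]
      exact (ciInf_le (OrderBot.bddBelow _) N).trans (hN N le_rfl).2.le
  intro n
  have hlt : (⨅ m, gap v s m) < gap v t n :=
    (hle (n + 1)).trans_lt (ht.strictAnti_gap n.lt_succ_self)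
  -- The limiting distance to `t n` exceeds the breadth of `s`, so `t n` is not a pseudo-limit and
  -- the distance is eventually equal to `gap v t n`. A late `s N` is closer to α than to `t n`,
  -- which transfers this distance to α.
  have hnot : ¬ IsPseudoLimit v u s (algebraMap K C (t n)) := fun h => by
    refine hlt.ne' (tendsto_nhds_unique (hlim n) (hs.tendsto_gap.congr fun m => ?_))
    rw [← h m, ← map_sub, hu]
  obtain ⟨c, N, hN⟩ := hs.eventually_of_not_isPseudoLimit hu hnot
  have h2 : gap v t n = c := by
    refine tendsto_nhds_unique (hlim n) (tendsto_const_nhds.congr' ?_)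
    filter_upwards [eventually_ge_atTop N] with m hm
    rw [← (hN m hm).1, ← map_sub, hu]
  obtain ⟨h3, h4⟩ := hN N le_rfl
  rw [← sub_add_sub_cancel _ (algebraMap K C (s N)), Valuation.map_add_eq_of_lt_left,
    Valuation.map_sub_swap, h3, h2]
  rwa [hα N, Valuation.map_sub_swap, h3]

lemma limitOrder_eq (hs : IsPseudoConvergent v s) (ht : IsPseudoConvergent v t)
    (hu : ∀ x : K, u (algebraMap K C x) = v x)
    (hws : IsOstrowskiValuation v s w) (hwt : IsOstrowskiValuation v t w) :
    limitOrder v u s = limitOrder v u t := by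
  have h : IsPseudoLimit v u s = IsPseudoLimit v u t := by
    ext α
    exact ⟨isPseudoLimit hs ht hu hws hwt, isPseudoLimit ht hs hu hwt hws⟩
  ext φ
  rw [limitOrder, limitOrder, limitRoots, limitRoots, limitRoots, limitRoots, h]

lemma VE_eq [IsAlgClosed C] [Algebra.IsAlgebraic K C]
    (hs : IsPseudoConvergent v s) (ht : IsPseudoConvergent v t)
    (hu : ∀ x : K, u (algebraMap K C x) = v x)
    (hws : IsOstrowskiValuation v s w) (hwt : IsOstrowskiValuation v t w) :
    VE v s = VE v t := by
  ext φ
  rw [mem_VE_iff hs hu hws, mem_VE_iff ht hu hwt, limitOrder_eq hs ht hu hws hwt]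

/-- If the value group is dense, `w_E` is determined by its valuation ring. -/
lemma eq_of_valuationSubring_eq (hd : ∀ x y : ℝ≥0, x < y → ∃ c : K, x < v c ∧ v c < y)
    {w' : Valuation (RatFunc K) ℝ≥0}
    (hw : IsOstrowskiValuation v s w) (hw' : IsOstrowskiValuation v t w')
    (h : w.valuationSubring = w'.valuationSubring) : w = w' := by
  have hle : ∀ {s t : ℕ → K} {w w' : Valuation (RatFunc K) ℝ≥0}, IsOstrowskiValuation v s w →
      IsOstrowskiValuation v t w' → w.valuationSubring = w'.valuationSubring →
      ∀ φ, w φ ≤ w' φ := by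
    intro s t w w' hw hw' h φ
    by_contra! hlt
    obtain ⟨c, h1, h2⟩ := hd _ _ hlt
    have hc : 0 < v c := zero_le.trans_lt h1
    have h3 : φ / RatFunc.C c ∈ w'.valuationSubring := by
      rw [Valuation.mem_valuationSubring_iff, map_div₀, hw'.map_C]
      exact (div_le_one hc).2 h1.le
    rw [← h, Valuation.mem_valuationSubring_iff, map_div₀, hw.map_C, div_le_one hc] at h3
    exact absurd h3 h2.not_ge
  ext φ
  exact congrArg _ (le_antisymm (hle hw hw' h φ) (hle hw' hw h.symm φ))

/-- `W_E` is determined by `V_E`. -/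
lemma mem_valuationSubring_iff [IsAlgClosed C] [Algebra.IsAlgebraic K C]
    (hd : ∀ x y : ℝ≥0, x < y → ∃ c : K, x < v c ∧ v c < y)
    (hs : IsPseudoConvergent v s) (hu : ∀ x : K, u (algebraMap K C x) = v x)
    (hw : IsOstrowskiValuation v s w) (φ : RatFunc K) :
    φ ∈ w.valuationSubring ↔ ∀ c : K, v c < 1 → RatFunc.C c * φ ∈ VE v s := by
  rw [Valuation.mem_valuationSubring_iff]
  constructor
  · intro h c hc
    rw [mem_VE_iff hs hu hw, map_mul, hw.map_C]
    exact Or.inl (mul_lt_one_of_lt_of_le hc h)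
  · intro h
    by_contra! h1
    have hpos := zero_lt_one.trans h1
    obtain ⟨c, hc, hc1⟩ := hd _ _ ((inv_lt_one₀ hpos).2 h1)
    have h2 := h c hc1
    rw [mem_VE_iff hs hu hw, map_mul, hw.map_C] at h2
    have h3 : 1 < v c * w φ := (inv_lt_iff_one_lt_mul₀ hpos).1 hc
    rcases h2 with h2 | h2
    · exact absurd h2 h3.not_gt
    · exact h3.ne' h2.1

end IsOstrowskiValuation

end RationalFunctions

/-! ### Continuity: neighbourhoods of W_E -/

section Continuity

/-- One factor is bounded by `r` and the others by δ; the extra δ on the left avoids the exponent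
`card M - 1`. -/
lemma multiset_prod_mul_le {ι : Type*} {M : Multiset ι} {f : ι → ℝ≥0} {δ r : ℝ≥0}
    (hf : ∀ i ∈ M, f i ≤ δ) {i : ι} (hi : i ∈ M) (hr : f i ≤ r) :
    (M.map f).prod * δ ≤ δ ^ Multiset.card M * r := by
  obtain ⟨M, rfl⟩ := Multiset.exists_cons_of_mem hi
  have h : (M.map f).prod ≤ δ ^ Multiset.card (M.map f) := Multiset.prod_le_pow_card _ _ fun x hx => by
    obtain ⟨j, hj, rfl⟩ := Multiset.mem_map.1 hx
    exact hf j (Multiset.mem_cons_of_mem hj)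
  rw [Multiset.card_map] at h
  rw [Multiset.map_cons, Multiset.prod_cons, Multiset.card_cons, pow_succ]
  calc f i * (M.map f).prod * δ ≤ r * δ ^ Multiset.card M * δ := by gcongr
    _ = _ := by ring

lemma multiset_prod_eq {ι : Type*} {M : Multiset ι} {f : ι → ℝ≥0} {δ : ℝ≥0}
    (hf : ∀ i ∈ M, f i = δ) : (M.map f).prod = δ ^ Multiset.card M := by
  rw [Multiset.map_congr rfl hf, Multiset.map_const', Multiset.prod_replicate]

/-- Passing from radius δ to ρ multiplies the sides by (ρ/δ)^a and (ρ/δ)^b, and the hypothesis on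
exponents says that the right side gains at least as much. -/
lemma mul_pow_le_mul_pow {γ₁ γ₂ δ ρ : ℝ≥0} {a b : ℕ} (hδ : 0 < δ)
    (hab : δ ≤ ρ ∧ a ≤ b ∨ ρ ≤ δ ∧ b ≤ a)
    (h : γ₁ * δ ^ a ≤ γ₂ * δ ^ b) : γ₁ * ρ ^ a ≤ γ₂ * ρ ^ b := by
  have e : ∀ n, ρ ^ n = δ ^ n * (ρ / δ) ^ n := fun n => by
    rw [← mul_pow, mul_div_cancel₀ _ hδ.ne']
  rw [e, e, ← mul_assoc, ← mul_assoc]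
  refine mul_le_mul' h ?_
  rcases hab with ⟨h1, hab⟩ | ⟨h1, hab⟩
  · exact pow_le_pow_right₀ ((one_le_div hδ).2 h1) hab
  · exact pow_le_pow_of_le_one zero_le ((div_le_one hδ).2 h1) hab

variable {K : Type*} [Field K] {v : Valuation K ℝ≥0} {s t : ℕ → K}
  {C : Type*} [Field C] [Algebra K C] {u : Valuation C ℝ≥0}

lemma IsPseudoConvergent.exists_antitone (ht : IsPseudoConvergent v t)
    (hu : ∀ x : K, u (algebraMap K C x) = v x) (α : C) :
    ∃ N, ∀ n ≥ N, ∀ m ≥ n, u (algebraMap K C (t m) - α) ≤ u (algebraMap K C (t n) - α) := by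
  by_cases h : IsPseudoLimit v u t α
  · refine ⟨0, fun n _ m hm => ?_⟩
    rw [h, h]
    exact ht.strictAnti_gap.antitone hm
  · obtain ⟨c, N, hN⟩ := ht.eventually_of_not_isPseudoLimit hu h
    refine ⟨N, fun n hn m hm => ?_⟩
    rw [(hN n hn).1, (hN m (le_trans hn hm)).1]

lemma IsPseudoLimit.map_sub_le {α β : C}
    (hα : IsPseudoLimit v u s α) (hβ : IsPseudoLimit v u s β) :
    u (α - β) ≤ ⨅ n, gap v s n := by
  refine le_ciInf fun n => ?_
  rw [← sub_sub_sub_cancel_left β α (algebraMap K C (s n))]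
  refine (u.map_sub _ _).trans ?_
  rw [hα n, hβ n, max_self]

lemma map_sub_eq_of_lt {x α β : C} {u : Valuation C ℝ≥0} (h : u (α - β) < u (x - α)) :
    u (x - β) = u (x - α) := by
  rw [← sub_add_sub_cancel x α β, Valuation.map_add_eq_of_lt_left _ h]

/-- A condition defining a neighbourhood of `W_E`: late terms of the sequence are close to a given
term of `E`. -/
lemma IsOstrowskiValuation.eventually_map_sub_lt {w : Valuation (RatFunc K) ℝ≥0}
    (hw : IsOstrowskiValuation v t w) {c : K} {r : ℝ≥0}
    (h : w (algebraMap _ _ (Polynomial.X - Polynomial.C c)) < r) :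
    ∀ᶠ n in atTop, v (t n - c) < r :=
  (hw.tendsto_sub c).eventually (gt_mem_nhds h)

lemma IsOstrowskiValuation.tendsto_polynomial {w : Valuation (RatFunc K) ℝ≥0}
    (hw : IsOstrowskiValuation v t w) (p : Polynomial K) :
    Tendsto (fun n => v (p.eval (t n))) atTop (𝓝 (w (algebraMap _ _ p))) := by
  refine (hw _).congr fun n => ?_
  rw [RatFunc.eval_algebraMap]
  simp

/-- If `φ` lies in `V_E`, finitely many membership conditions satisfied by `W_E` force `φ ∈ V_F` for
every `W_F` that satisfies them. -/
theorem IsOstrowskiValuation.exists_finset [IsAlgClosed C] [Algebra.IsAlgebraic K C]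
    (hd : ∀ x y : ℝ≥0, x < y → ∃ c : K, x < v c ∧ v c < y)
    (hu : ∀ x : K, u (algebraMap K C x) = v x)
    {w : Valuation (RatFunc K) ℝ≥0} (hs : IsPseudoConvergent v s)
    (hw : IsOstrowskiValuation v s w) {φ : RatFunc K} (hφ : φ ∈ VE v s) :
    ∃ S : Finset (RatFunc K), (∀ ψ ∈ S, w ψ ≤ 1) ∧
      ∀ (t : ℕ → K) (w' : Valuation (RatFunc K) ℝ≥0), IsPseudoConvergent v t →
        IsOstrowskiValuation v t w' → (∀ ψ ∈ S, w' ψ ≤ 1) → φ ∈ VE v t := by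
  classical
  rw [hw.mem_VE_iff hs hu] at hφ
  rcases hφ with hφ | ⟨hφ1, hord⟩
  · obtain ⟨c, hc, hc1⟩ := hd _ _ hφ
    have hc0 : 0 < v c := zero_le.trans_lt hc
    refine ⟨{φ / RatFunc.C c}, ?_, fun t w' ht hw' h => ?_⟩
    · simp only [Finset.mem_singleton, forall_eq, map_div₀, hw.map_C]
      exact (div_le_one hc0).2 hc.le
    · simp only [Finset.mem_singleton, forall_eq, map_div₀, hw'.map_C] at h
      rw [hw'.mem_VE_iff ht hu]
      exact Or.inl (((div_le_one hc0).1 h).trans_lt hc1)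
  have hφ0 : φ ≠ 0 := by
    rintro rfl
    simp at hφ1
  have hnum := RatFunc.num_ne_zero hφ0
  have hden := φ.denom_ne_zero
  obtain ⟨N, ⟨γ₁, hγ₁, hγ₁', h₁⟩, γ₂, hγ₂, hγ₂', h₂⟩ :=
    ((hs.eventually_local (u := u) hu hnum).and (hs.eventually_local (u := u) hu hden)).exists
  set A := limitRoots v u s φ.num with hA
  set B := limitRoots v u s φ.denom with hB
  have hlim : ∀ α ∈ A + B, IsPseudoLimit v u s α := fun α hα =>
    (Multiset.mem_add.1 hα).elim isPseudoLimit_of_mem_limitRoots isPseudoLimit_of_mem_limitRoots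
  set δ := ⨅ n, gap v s n with hδ
  have hdist : ∀ α ∈ A + B, ∀ β ∈ A + B, u (α - β) ≤ δ := fun α hα β hβ =>
    (hlim α hα).map_sub_le (hlim β hβ)
  have hab : Multiset.card A ≤ Multiset.card B := by
    rw [limitOrder] at hord
    exact_mod_cast sub_nonpos.1 hord
  -- the values of numerator and denominator
  have hwnum : w (algebraMap _ _ φ.num) = γ₁ * δ ^ Multiset.card A := by
    refine tendsto_nhds_unique (hw.tendsto_polynomial φ.num)
      (((hs.tendsto_gap.pow (Multiset.card A)).const_mul γ₁).congr' ?_)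
    filter_upwards [eventually_gt_atTop N] with n hn
    rw [h₁ _ (hs.map_sub_lt hn), limitRoots_prod]
  have hwden : w (algebraMap _ _ φ.denom) = γ₂ * δ ^ Multiset.card B := by
    refine tendsto_nhds_unique (hw.tendsto_polynomial φ.denom)
      (((hs.tendsto_gap.pow (Multiset.card B)).const_mul γ₂).congr' ?_)
    filter_upwards [eventually_gt_atTop N] with n hn
    rw [h₂ _ (hs.map_sub_lt hn), limitRoots_prod]
  have hwden0 : w (algebraMap _ _ φ.denom) ≠ 0 :=
    (Valuation.ne_zero_iff w).2 (RatFunc.algebraMap_ne_zero hden)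
  have heq : γ₁ * δ ^ Multiset.card A = γ₂ * δ ^ Multiset.card B := by
    rw [← hwnum, ← hwden]
    have h := hφ1
    rw [← RatFunc.num_div_denom φ, map_div₀] at h
    exact (div_eq_one_iff_eq hwden0).1 h
  set g := φ.num * φ.denom with hg
  set κ := γ₁ * γ₂ * δ ^ Multiset.card (A + B) with hκ
  have hwg : w (algebraMap _ _ g) = κ := by
    rw [hg, map_mul, map_mul, hwnum, hwden, hκ, Multiset.card_add, pow_add]
    ring
  have hg0 : algebraMap (Polynomial K) (RatFunc K) g ≠ 0 :=
    RatFunc.algebraMap_ne_zero (mul_ne_zero hnum hden)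
  have hκ0 : 0 < κ := by
    rw [← hwg]
    exact pos_iff_ne_zero.2 ((Valuation.ne_zero_iff w).2 hg0)
  -- At breadth zero a limit root would give w(g) = 0, impossible for a nonzero `g`.
  have hδ0 : ∀ α ∈ A + B, 0 < δ := fun α hα => by
    refine pos_iff_ne_zero.2 fun h0 => hκ0.ne' ?_
    rw [hκ, h0, zero_pow, mul_zero]
    exact (Multiset.card_pos_iff_exists_mem.2 ⟨α, hα⟩).ne'
  -- comparison of numerator and denominator at points equidistant from the limit roots
  have hcmp : ∀ x : K, v (x - s (N + 1)) < gap v s N → ∀ ρ,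
      (∀ α ∈ A + B, u (algebraMap K C x - α) = ρ) →
      γ₁ * ρ ^ Multiset.card A ≤ γ₂ * ρ ^ Multiset.card B →
      v (φ.eval (RingHom.id K) x) ≤ 1 := fun x hx ρ hρ hle => by
    rw [eval_id, map_div₀]
    refine div_le_one_of_le₀ ?_ zero_le
    rw [h₁ x hx, h₂ x hx, multiset_prod_eq fun α hα => hρ α (Multiset.mem_add.2 (Or.inl hα)),
      multiset_prod_eq fun α hα => hρ α (Multiset.mem_add.2 (Or.inr hα))]
    exact hle
  -- Limit roots are within δ of each other, so a point farther than δ from one is equidistant from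
  -- all; enlarging the radius preserves the comparison because `card A ≤ card B`.
  have hfar : ∀ x : K, v (x - s (N + 1)) < gap v s N → ∀ α ∈ A + B,
      δ < u (algebraMap K C x - α) → v (φ.eval (RingHom.id K) x) ≤ 1 := fun x hx α hα hlt =>
    hcmp x hx _ (fun β hβ => map_sub_eq_of_lt ((hdist α hα β hβ).trans_lt hlt))
      (mul_pow_le_mul_pow (hδ0 α hα) (Or.inl ⟨hlt.le, hab⟩) heq.le)
  -- the neighbourhood conditions
  set ℓ := algebraMap (Polynomial K) (RatFunc K) (Polynomial.X - Polynomial.C (s (N + 1))) with hℓ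
  -- The value of `e` is the gap at `N + 1`, smaller than that at `N`: a non-strict bound by it
  -- places late terms in the open ball of radius `gap v s N`.
  set e := s (N + 2) - s (N + 1) with he
  have hve : v e = gap v s (N + 1) := rfl
  have hℓw : w (ℓ / RatFunc.C e) ≤ 1 := by
    rw [map_div₀, hw.map_C]
    refine div_le_one_of_le₀ (le_of_tendsto (hw.tendsto_sub _) ?_) zero_le
    filter_upwards [eventually_gt_atTop (N + 1)] with n hn
    rw [hs.map_sub hn, hve]
  have hnear : ∀ (t : ℕ → K) (w' : Valuation (RatFunc K) ℝ≥0), IsOstrowskiValuation v t w' →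
      w' (ℓ / RatFunc.C e) ≤ 1 → ∀ᶠ n in atTop, v (t n - s (N + 1)) < gap v s N := by
    intro t w' hw' h
    rw [map_div₀, hw'.map_C, div_le_one (by rw [hve]; exact hs.gap_pos _)] at h
    exact hw'.eventually_map_sub_lt (h.trans_lt (hs.strictAnti_gap N.lt_succ_self))
  -- a lower bound for the value of `g` keeps the sequence away from the limit roots
  have hclose : ∀ (t : ℕ → K) (w' : Valuation (RatFunc K) ℝ≥0), IsOstrowskiValuation v t w' →
      w' (ℓ / RatFunc.C e) ≤ 1 → ∀ α ∈ A + B, ∀ r ≤ δ,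
      (∀ᶠ n in atTop, u (algebraMap K C (t n) - α) ≤ r) →
      w' (algebraMap _ _ g) * δ ≤ κ * r := by
    intro t w' hw' hball α hα r hr hev
    refine le_of_tendsto ((hw'.tendsto_polynomial g).mul_const δ) ?_
    filter_upwards [hev, hnear t w' hw' hball] with n hn hn'
    have hle : ∀ β ∈ A + B, u (algebraMap K C (t n) - β) ≤ δ := fun β hβ => by
      rw [← sub_add_sub_cancel _ α]
      exact u.map_add_le (hn.trans hr) (hdist α hα β hβ)
    have := multiset_prod_mul_le hle hα hn
    rw [hg, Polynomial.eval_mul, map_mul, h₁ _ hn', h₂ _ hn']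
    calc _ = γ₁ * γ₂ * (((A + B).map fun β => u (algebraMap K C (t n) - β)).prod * δ) := by
          rw [Multiset.map_add, Multiset.prod_add]
          ring
      _ ≤ γ₁ * γ₂ * (δ ^ Multiset.card (A + B) * r) := by gcongr
      _ = κ * r := by rw [hκ]; ring
  by_cases hcomm : IsCommensurable v κ
  -- Here κ^m is a value, so the exact bound w'(g) ≥ κ can be imposed through c/g^m. It keeps late
  -- terms at distance at least δ from every limit root: either exactly δ from all of them, or
  -- farther as in `hfar`.
  · obtain ⟨m, hm, c, hc⟩ := hcomm
    have hgm : ∀ w' : Valuation (RatFunc K) ℝ≥0, 0 < w' (algebraMap _ _ g) ^ m := fun w' =>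
      pow_pos (pos_iff_ne_zero.2 ((Valuation.ne_zero_iff w').2 hg0)) m
    refine ⟨{ℓ / RatFunc.C e, RatFunc.C c / algebraMap _ _ g ^ m}, ?_, fun t w' ht hw' h => ?_⟩
    · simp only [Finset.mem_insert, Finset.mem_singleton, forall_eq_or_imp, forall_eq]
      refine ⟨hℓw, ?_⟩
      rw [map_div₀, map_pow, hw.map_C, hwg, hc]
      exact div_self_le_one _
    · simp only [Finset.mem_insert, Finset.mem_singleton, forall_eq_or_imp, forall_eq] at h
      obtain ⟨hball, hlow⟩ := h
      rw [map_div₀, map_pow, hw'.map_C, div_le_one (hgm w'), ← hc] at hlow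
      have hlow : κ ≤ w' (algebraMap _ _ g) := le_of_pow_le_pow_left₀ hm zero_le hlow
      have hge : ∀ α ∈ (A + B).toFinset,
          ∀ᶠ n in atTop, δ ≤ u (algebraMap K C (t n) - α) := fun α hα => by
        rw [Multiset.mem_toFinset] at hα
        obtain ⟨M, hM⟩ := ht.exists_antitone (u := u) hu α
        by_contra h
        rw [Filter.not_eventually] at h
        obtain ⟨n, hn, hlt⟩ := (h.and_eventually (eventually_ge_atTop M)).exists
        rw [not_le] at hn
        have h1 := hclose t w' hw' hball α hα _ hn.le
          (eventually_atTop.2 ⟨n, fun m hm => hM n hlt m hm⟩)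
        have h2 : κ * δ ≤ w' (algebraMap _ _ g) * δ := by gcongr
        exact absurd hn (le_of_mul_le_mul_left (h2.trans h1) hκ0).not_gt
      rw [ht.mem_VE_iff]
      filter_upwards [(Filter.eventually_all_finset _).2 hge, hnear t w' hw' hball] with n hn hn'
      by_cases hex : ∃ α ∈ A + B, δ < u (algebraMap K C (t n) - α)
      · obtain ⟨α, hα, hlt⟩ := hex
        exact hfar _ hn' α hα hlt
      · push Not at hex
        exact hcmp _ hn' δ
          (fun α hα => le_antisymm (hex α hα) (hn α (Multiset.mem_toFinset.2 hα))) heq.le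
  -- Now δ is incommensurable, so w(φ) = 1 forces equal numbers of limit zeros and poles and γ₁ =
  -- γ₂. Any point equidistant from the limit roots is then good, whatever the radius.
  · have hδc : ¬ IsCommensurable v δ := fun h => hcomm <| by
      refine (hγ₁'.mul hγ₂').mul ?_
      rw [← Multiset.prod_replicate]
      refine IsCommensurable.multiset_prod fun x hx => ?_
      rw [Multiset.eq_of_mem_replicate hx]
      exact h
    obtain ⟨α, hα⟩ : ∃ α, α ∈ A + B := by
      by_contra! h
      refine hcomm ?_
      rw [hκ, Multiset.eq_zero_of_forall_notMem h, Multiset.card_zero, pow_zero, mul_one]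
      exact hγ₁'.mul hγ₂'
    have hδ' := hδ0 α hα
    have hcard : Multiset.card A = Multiset.card B := by
      by_contra hne
      refine hδc (IsCommensurable.of_zpow
        (n := (Multiset.card A : ℤ) - Multiset.card B) (sub_ne_zero.2 (by exact_mod_cast hne)) ?_)
      have : δ ^ ((Multiset.card A : ℤ) - Multiset.card B) = γ₂ / γ₁ := by
        rw [zpow_sub₀ hδ'.ne', zpow_natCast, zpow_natCast,
          div_eq_div_iff (pow_pos hδ' _).ne' hγ₁, mul_comm, heq]
      rw [this]
      exact hγ₂'.div hγ₁'
    have hγ : γ₁ = γ₂ := by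
      rw [hcard] at heq
      exact mul_right_cancel₀ (pow_pos hδ' _).ne' heq
    -- Distances between roots are commensurable, hence different from δ, so ε < δ. This leaves room
    -- for a value between κε/δ and κ; the bound w'(g) ≥ v(c) keeps late terms farther than ε from
    -- α, hence equidistant from all limit roots.
    set ε := (A + B).toFinset.sup fun β => u (α - β) with hε
    have hεδ : ε < δ := by
      refine (Finset.sup_lt_iff hδ').2 fun β hβ => ?_
      refine lt_of_le_of_ne (hdist α hα β (Multiset.mem_toFinset.1 hβ)) fun h => hδc ?_
      rw [← h]
      exact IsCommensurable.of_algebraic hu (Algebra.IsAlgebraic.isAlgebraic _)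
    obtain ⟨c, hc1, hc2⟩ := hd (κ * ε / δ) κ (by
      rw [div_lt_iff₀ hδ']
      exact mul_lt_mul_of_pos_left hεδ hκ0)
    have hgp : ∀ w' : Valuation (RatFunc K) ℝ≥0, 0 < w' (algebraMap _ _ g) := fun w' =>
      pos_iff_ne_zero.2 ((Valuation.ne_zero_iff w').2 hg0)
    refine ⟨{ℓ / RatFunc.C e, RatFunc.C c / algebraMap _ _ g}, ?_, fun t w' ht hw' h => ?_⟩
    · simp only [Finset.mem_insert, Finset.mem_singleton, forall_eq_or_imp, forall_eq]
      refine ⟨hℓw, ?_⟩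
      rw [map_div₀, hw.map_C, hwg]
      exact div_le_one_of_le₀ hc2.le zero_le
    · simp only [Finset.mem_insert, Finset.mem_singleton, forall_eq_or_imp, forall_eq] at h
      obtain ⟨hball, hlow⟩ := h
      rw [map_div₀, hw'.map_C, div_le_one (hgp w')] at hlow
      have hlt : κ * ε < w' (algebraMap _ _ g) * δ :=
        (div_lt_iff₀ hδ').1 (hc1.trans_le hlow)
      have hge : ∀ᶠ n in atTop, ε < u (algebraMap K C (t n) - α) := by
        obtain ⟨M, hM⟩ := ht.exists_antitone (u := u) hu α
        by_contra h
        rw [Filter.not_eventually] at h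
        obtain ⟨n, hn, hMn⟩ := (h.and_eventually (eventually_ge_atTop M)).exists
        rw [not_lt] at hn
        exact absurd (hclose t w' hw' hball α hα ε hεδ.le
          (eventually_atTop.2 ⟨n, fun m hm => (hM n hMn m hm).trans hn⟩)) hlt.not_ge
      rw [ht.mem_VE_iff]
      filter_upwards [hge, hnear t w' hw' hball] with n hn hn'
      refine hcmp _ hn' (u (algebraMap K C (t n) - α)) (fun β hβ => map_sub_eq_of_lt ?_) ?_
      · exact (Finset.le_sup (f := fun β => u (α - β)) (Multiset.mem_toFinset.2 hβ)).trans_lt hn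
      · rw [hγ, hcard]

end Continuity

/-! ### Existence of w_E and the sequences showing that Ψ is not an embedding -/

section Existence

variable {K : Type*} [Field K] {v : Valuation K ℝ≥0} {s : ℕ → K}
  {C : Type*} [Field C] [Algebra K C] {u : Valuation C ℝ≥0}

/-- If the breadth is nonzero, `w_E` is a valuation. -/
theorem IsPseudoConvergent.exists_isOstrowskiValuation [IsAlgClosed C] [Algebra.IsAlgebraic K C]
    (hs : IsPseudoConvergent v s) (hu : ∀ x : K, u (algebraMap K C x) = v x) {δ : ℝ≥0} (hδ : δ ≠ 0)
    (hlim : Tendsto (gap v s) atTop (𝓝 δ)) :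
    ∃ w : Valuation (RatFunc K) ℝ≥0, IsOstrowskiValuation v s w := by
  have h : ∀ φ : RatFunc K, ∃ l : ℝ≥0,
      Tendsto (fun n => v (φ.eval (RingHom.id K) (s n))) atTop (𝓝 l) := fun φ => by
    rcases eq_or_ne φ 0 with rfl | hφ
    · exact ⟨0, by simp⟩
    obtain ⟨γ, -, hγ⟩ := hs.eventually_eval (u := u) hu hφ
    exact ⟨_, ((hlim.zpow₀ _ (Or.inl hδ)).const_mul γ).congr' (hγ.mono fun n h => h.symm)⟩
  choose l hl using h
  refine ⟨⟨⟨⟨l, ?_⟩, ?_, ?_⟩, ?_⟩, hl⟩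
  · exact tendsto_nhds_unique (hl 0) (by simp)
  · exact tendsto_nhds_unique (hl 1) (by simp)
  · refine fun φ ψ => tendsto_nhds_unique (hl _) (((hl φ).mul (hl ψ)).congr' ?_)
    filter_upwards [hs.eventually_eval_mul φ ψ] with n hn
    rw [hn, map_mul]
  · refine fun φ ψ => le_of_tendsto_of_tendsto (hl _) ((hl φ).max (hl ψ)) ?_
    filter_upwards [hs.eventually_eval_add φ ψ] with n hn
    rw [hn]
    exact v.map_add _ _

lemma gap_of_strictAnti (h : StrictAnti fun n => v (s n)) : gap v s = fun n => v (s n) := by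
  ext n
  rw [gap, Valuation.map_sub_eq_of_lt_right _ (h n.lt_succ_self)]

lemma isPseudoConvergent_of_strictAnti (h : StrictAnti fun n => v (s n)) :
    IsPseudoConvergent v s := fun n => by
  have h1 := congrFun (gap_of_strictAnti h) n
  have h2 := congrFun (gap_of_strictAnti h) (n + 1)
  rw [gap] at h1 h2
  rw [h1, h2]
  exact h n.lt_succ_self

lemma exists_strictAnti_tendsto_one (hd : ∀ x y : ℝ≥0, x < y → ∃ c : K, x < v c ∧ v c < y) :
    ∃ s : ℕ → K, StrictAnti (fun n => v (s n)) ∧ (∀ n, 1 < v (s n)) ∧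
      Tendsto (fun n => v (s n)) atTop (𝓝 1) := by
  obtain ⟨x, hx, hx1, hlim⟩ := exists_seq_strictAnti_tendsto (1 : ℝ≥0)
  choose s hs1 hs2 using fun n : ℕ => hd _ _ (hx n.lt_succ_self)
  refine ⟨s, strictAnti_nat_of_succ_lt fun n => (hs2 _).trans (hs1 n),
    fun n => (hx1 _).trans (hs1 n), ?_⟩
  exact tendsto_of_tendsto_of_tendsto_of_le_of_le tendsto_const_nhds hlim
    (fun n => ((hx1 _).trans (hs1 n)).le) fun n => (hs2 n).le

/-- If `v (s n)` decreases to `1`, the rings `V_F` for the sequences `F = s k • E` converge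
to `V_E`. -/
lemma eventually_mem_VE_smul [IsAlgClosed C] [Algebra.IsAlgebraic K C]
    (hu : ∀ x : K, u (algebraMap K C x) = v x) (hanti : StrictAnti fun n => v (s n))
    (h1 : ∀ n, 1 < v (s n)) (hlim : Tendsto (fun n => v (s n)) atTop (𝓝 1))
    {φ : RatFunc K} (hφ : φ ∈ VE v s) :
    ∀ᶠ k in atTop, φ ∈ VE v fun n => s k * s n := by
  have hs := isPseudoConvergent_of_strictAnti hanti
  have hpos : ∀ n, 0 < v (s n) := fun n => zero_lt_one.trans (h1 n)
  have hantit : ∀ k, StrictAnti fun n => v (s k * s n) := fun k m n h => by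
    simp only [map_mul]
    exact mul_lt_mul_of_pos_left (hanti h) (hpos k)
  have hst : ∀ k, IsPseudoConvergent v fun n => s k * s n := fun k =>
    isPseudoConvergent_of_strictAnti (hantit k)
  rcases eq_or_ne φ 0 with rfl | hφ0
  · refine Eventually.of_forall fun k => ?_
    rw [(hst k).mem_VE_iff]
    simp
  obtain ⟨N, ⟨γ₁, hγ₁, -, h₁⟩, γ₂, hγ₂, -, h₂⟩ :=
    ((hs.eventually_local (u := u) hu (RatFunc.num_ne_zero hφ0)).and
      (hs.eventually_local (u := u) hu φ.denom_ne_zero)).exists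
  rw [gap_of_strictAnti hanti] at h₁ h₂
  have hzero : IsPseudoLimit v u s (0 : C) := fun n => by
    rw [sub_zero, hu, gap_of_strictAnti hanti]
  have hbreadth : ⨅ n, gap v s n = 1 := by
    refine tendsto_nhds_unique hs.tendsto_gap ?_
    rwa [gap_of_strictAnti hanti]
  -- Since 0 is a pseudo-limit and the breadth is 1, limit roots have value at most 1. Beyond radius
  -- 1 the membership test for φ thus depends on `v x` alone.
  have hdist : ∀ x : K, 1 < v x → ∀ p : Polynomial K, ∀ α ∈ limitRoots v u s p,
      u (algebraMap K C x - α) = v x := fun x hx p α hα => by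
    have h := (isPseudoLimit_of_mem_limitRoots hα).map_sub_le hzero
    rw [hbreadth, sub_zero] at h
    rw [Valuation.map_sub_eq_of_lt_left, hu]
    rw [hu]
    exact h.trans_lt hx
  set a := Multiset.card (limitRoots v u s φ.num)
  set b := Multiset.card (limitRoots v u s φ.denom)
  have hval : ∀ x : K, 1 < v x → v x < v (s N) →
      (v (φ.eval (RingHom.id K) x) ≤ 1 ↔ γ₁ * v x ^ a ≤ γ₂ * v x ^ b) := fun x hx hxN => by
    have hball : v (x - s (N + 1)) < v (s N) :=
      (v.map_sub _ _).trans_lt (max_lt hxN (hanti N.lt_succ_self))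
    rw [eval_id, map_div₀, h₁ _ hball, h₂ _ hball, multiset_prod_eq (hdist x hx _),
      multiset_prod_eq (hdist x hx _), div_le_one]
    exact mul_pos (pos_iff_ne_zero.2 hγ₂) (pow_pos (zero_lt_one.trans hx) _)
  rw [hs.mem_VE_iff, eventually_atTop] at hφ
  obtain ⟨M, hM⟩ := hφ
  have hle : ∀ n, N < n → M ≤ n → γ₁ * v (s n) ^ a ≤ γ₂ * v (s n) ^ b := fun n hn hn' =>
    (hval _ (h1 n) (hanti hn)).1 (hM n hn')
  set L := max (N + 1) M
  have hL : N < L := Nat.lt_of_succ_le (le_max_left _ _)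
  filter_upwards [eventually_gt_atTop L] with k hk
  rw [(hst k).mem_VE_iff]
  have htend : Tendsto (fun n => v (s k * s n)) atTop (𝓝 (v (s k))) := by
    simp only [map_mul]
    simpa using hlim.const_mul (v (s k))
  filter_upwards [htend.eventually (gt_mem_nhds (hanti hk))] with n hn
  have hgt : v (s k) < v (s k * s n) := by
    rw [map_mul]
    exact lt_mul_of_one_lt_right (hpos k) (h1 n)
  rw [hval _ ((h1 k).trans hgt) (hn.trans (hanti hL))]
  -- The late terms of the scaled sequence have values between those of `s k` and `s L`; the
  -- comparison is carried outwards from `s k` or inwards from `s L` according to the sign of `a -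
  -- b`.
  rcases le_total a b with hab | hab
  · exact mul_pow_le_mul_pow (hpos k) (Or.inl ⟨hgt.le, hab⟩)
      (hle k (hL.trans hk) ((le_max_right _ _).trans hk.le))
  · exact mul_pow_le_mul_pow (hpos L) (Or.inr ⟨hn.le, hab⟩) (hle L hL (le_max_right _ _))

end Existence

section Points

variable {K : Type*} [Field K] {v : Valuation K ℝ≥0} {s : ℕ → K}

/-- The valuation domain `W_E` as a point of `𝒲`. -/
noncomputable def pointW {w : Valuation (RatFunc K) ℝ≥0} (hs : IsPseudoConvergent v s)
    (hw : IsOstrowskiValuation v s w) : spaceW v :=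
  ⟨⟨w.valuationSubring, fun d => by
    have : algebraMap v.valuationSubring (RatFunc K) d = RatFunc.C (d : K) := rfl
    rw [this, Valuation.mem_valuationSubring_iff, hw.map_C]
    exact d.2⟩, s, w, hs, hw, rfl⟩

lemma Zar.isOpen_basicSet {D L : Type*} [CommRing D] [Field L] [Algebra D L] (φ : L) :
    IsOpen (Zar.basicSet φ : Set (Zar D L)) :=
  TopologicalSpace.isOpen_generateFrom_of_mem ⟨φ, rfl⟩

lemma Zar.ext_ring {D L : Type*} [CommRing D] [Field L] [Algebra D L] {A B : Zar D L}
    (h : A.ring = B.ring) : A = B := by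
  cases A
  cases B
  cases h
  rfl

end Points

end PseudoConvergent

/-! ### The map Ψ -/

open PseudoConvergent in
theorem proposition6p10 {K : Type*} [Field K] (v : Valuation K ℝ≥0)
    (hrank : ringKrullDim v.valuationSubring = 1)
    (hdisc : ¬ IsDiscreteValuationRing v.valuationSubring) :
    ∃ Ψ : PseudoConvergent.spaceW v → PseudoConvergent.spaceV v,
      (∀ (s : ℕ → K) (w : Valuation (RatFunc K) ℝ≥0),
        PseudoConvergent.IsPseudoConvergent v s →
        PseudoConvergent.IsOstrowskiValuation v s w →
        ∀ A : PseudoConvergent.spaceW v, A.1.ring = w.valuationSubring →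
          ((Ψ A).1.ring : Set (RatFunc K)) = PseudoConvergent.VE v s) ∧
      Continuous Ψ ∧ Function.Injective Ψ ∧ ¬ IsEmbedding Ψ := by
  have hc := exists_ne_zero_lt_one hrank
  have hd : ∀ x y : ℝ≥0, x < y → ∃ c : K, x < v c ∧ v c < y := fun x y hxy =>
    exists_between_of_denselyOrdered hc (denselyOrdered_range hrank hdisc) hxy
  obtain ⟨u, hu⟩ := exists_extension_algebraicClosure v hc
  -- The choice of a sequence for each ring is harmless: the ring determines w_E by density, and w_E
  -- determines V_E.
  choose σ ω hσ hω hring using fun A : spaceW v => A.2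
  have hΨ : ∀ (s : ℕ → K) (w : Valuation (RatFunc K) ℝ≥0), IsPseudoConvergent v s →
      IsOstrowskiValuation v s w → ∀ A : spaceW v, A.1.ring = w.valuationSubring →
      VE v (σ A) = VE v s := fun s w hs hw A hA => by
    have h : ω A = w := (hω A).eq_of_valuationSubring_eq hd hw ((hring A).symm.trans hA)
    exact IsOstrowskiValuation.VE_eq (hσ A) hs hu (h ▸ hω A) hw
  refine ⟨fun A => (hσ A).pointV hu, hΨ, ?_, ?_, ?_⟩
  · refine continuous_induced_rng.2 (continuous_generateFrom_iff.2 ?_)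
    rintro _ ⟨φ, rfl⟩
    refine isOpen_iff_mem_nhds.2 fun A hA => ?_
    obtain ⟨S, hS, hmem⟩ := (hω A).exists_finset hd hu (hσ A) (φ := φ) hA
    have hnhds : (⋂ ψ ∈ S, (Subtype.val ⁻¹' Zar.basicSet ψ : Set (spaceW v))) ∈ 𝓝 A := by
      refine (Filter.biInter_finset_mem S).2 fun ψ hψ =>
        ((Zar.isOpen_basicSet ψ).preimage continuous_subtype_val).mem_nhds ?_
      change ψ ∈ A.1.ring
      rw [hring A, Valuation.mem_valuationSubring_iff]
      exact hS ψ hψ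
    refine mem_of_superset hnhds fun B hB => hmem (σ B) (ω B) (hσ B) (hω B) fun ψ hψ => ?_
    have h : ψ ∈ B.1.ring := Set.mem_iInter₂.1 hB ψ hψ
    rwa [hring B, Valuation.mem_valuationSubring_iff] at h
  · intro A B h
    have hVE : VE v (σ A) = VE v (σ B) :=
      congrArg (fun P : spaceV v => (P.1.ring : Set (RatFunc K))) h
    refine Subtype.ext (Zar.ext_ring ?_)
    ext φ
    rw [hring A, hring B, (hω A).mem_valuationSubring_iff hd (hσ A) hu,
      (hω B).mem_valuationSubring_iff hd (hσ B) hu, hVE]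
  · intro hemb
    obtain ⟨s, hanti, h1, hlim⟩ := exists_strictAnti_tendsto_one hd
    have hpos : ∀ n, 0 < v (s n) := fun n => zero_lt_one.trans (h1 n)
    have hantit : ∀ k, StrictAnti fun n => v (s k * s n) := fun k m n h => by
      simp only [map_mul]
      exact mul_lt_mul_of_pos_left (hanti h) (hpos k)
    have hlimt : ∀ k, Tendsto (fun n => v (s k * s n)) atTop (𝓝 (v (s k))) := fun k => by
      simp only [map_mul]
      simpa using hlim.const_mul (v (s k))
    have hs := isPseudoConvergent_of_strictAnti hanti
    have hst : ∀ k, IsPseudoConvergent v fun n => s k * s n := fun k =>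
      isPseudoConvergent_of_strictAnti (hantit k)
    obtain ⟨w, hw⟩ := hs.exists_isOstrowskiValuation hu one_ne_zero
      (by rwa [gap_of_strictAnti hanti])
    choose w' hw' using fun k => (hst k).exists_isOstrowskiValuation hu (hpos k).ne'
      (by rw [gap_of_strictAnti (hantit k)]; exact hlimt k)
    have hX : w RatFunc.X = 1 := tendsto_nhds_unique (hw RatFunc.X) (by simpa using hlim)
    have hX' : ∀ k, w' k RatFunc.X = v (s k) := fun k =>
      tendsto_nhds_unique (hw' k RatFunc.X) (by simpa only [RatFunc.eval_X] using hlimt k)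
    -- An embedding would reflect the convergence of the rings V_{F_k}; but X has value 1 for `w`
    -- and value `v (s k) > 1` for `w' k`.
    have hconv : Tendsto (fun k => pointW (hst k) (hw' k)) atTop (𝓝 (pointW hs hw)) := by
      rw [hemb.isInducing.tendsto_nhds_iff, tendsto_subtype_rng,
        TopologicalSpace.tendsto_nhds_generateFrom_iff]
      rintro _ ⟨φ, rfl⟩ hφ
      have hφ' : φ ∈ VE v (σ (pointW hs hw)) := hφ
      rw [hΨ s w hs hw _ rfl] at hφ'
      filter_upwards [eventually_mem_VE_smul hu hanti h1 hlim hφ'] with k hk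
      change φ ∈ VE v (σ (pointW (hst k) (hw' k)))
      rwa [hΨ _ _ (hst k) (hw' k) _ rfl]
    have hopen : IsOpen (Subtype.val ⁻¹' Zar.basicSet RatFunc.X : Set (spaceW v)) :=
      (Zar.isOpen_basicSet RatFunc.X).preimage continuous_subtype_val
    obtain ⟨k, hk⟩ := (hconv.eventually (hopen.mem_nhds hX.le)).exists
    have hk' : w' k RatFunc.X ≤ 1 := hk
    rw [hX' k] at hk'
    exact absurd hk' (h1 k).not_ge
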